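/- A \emph{bi-infinite $x$-monotone curve} is the graph of a continuous function $f:\mathbb{R}\to\mathbb{R}$. A collection $\mathcal{L}$ of bi-infinite $x$-monotone curves is a \emph{pseudoline arrangement} if any two distinct elements of $\mathcal{L}$ intersect in exactly one point. A collection $\mathcal{H}$ of subsets of the plane is a \emph{pseudohalfplane arrangement} if there is a pseudoline arrangement $\mathcal{L}$ such that every $H\in\mathcal{H}$ is either the set of points strictly below an element of $\mathcal{L}$ or the set of points strictly above an element of $\mathcal{L}$. There is an absolute constant $c>0$ such that the following holds for every $n$. Let $P$ be a set of $n$ points in the plane and let $\mathcal{H}$ be a pseudohalfplane arrangement with $n$ elements. Then there are subsets $P_0\subseteq P$ and $\mathcal{H}_0\subseteq\mathcal{H}$ of size $|P_0|=|\mathcal{H}_0|\ge cn$ such that either $p\in H$ for every $p\in P_0$ and $H\in\mathcal{H}_0$, or $p\notin H$ for every $p\in P_0$ and $H\in\mathcal{H}_0$. -/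

import Mathlib

/-- A bi-infinite `x`-monotone curve: the graph of a continuous function `ℝ → ℝ`. -/
def IsBiinfiniteXMonotoneCurve (γ : Set (ℝ × ℝ)) : Prop :=
  ∃ f : ℝ → ℝ, Continuous f ∧ γ = {p : ℝ × ℝ | p.2 = f p.1}

/-- A pseudoline arrangement: a collection of bi-infinite `x`-monotone curves, any two distinct
members of which intersect in exactly one point. -/
def IsPseudolineArrangement (L : Set (Set (ℝ × ℝ))) : Prop :=
  (∀ γ ∈ L, IsBiinfiniteXMonotoneCurve γ) ∧
    ∀ γ ∈ L, ∀ δ ∈ L, γ ≠ δ → ∃! p : ℝ × ℝ, p ∈ γ ∩ δ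

/-- The set of points of the plane lying (strictly) below the curve `γ`. -/
def pointsBelow (γ : Set (ℝ × ℝ)) : Set (ℝ × ℝ) :=
  {p | ∃ y : ℝ, (p.1, y) ∈ γ ∧ p.2 < y}

/-- The set of points of the plane lying (strictly) above the curve `γ`. -/
def pointsAbove (γ : Set (ℝ × ℝ)) : Set (ℝ × ℝ) :=
  {p | ∃ y : ℝ, (p.1, y) ∈ γ ∧ y < p.2}

/-- A pseudohalfplane arrangement: each member is the set of points below, or the set of points
above, an element of one common pseudoline arrangement. -/
def IsPseudohalfplaneArrangement (H : Set (Set (ℝ × ℝ))) : Prop :=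
  ∃ L : Set (Set (ℝ × ℝ)), IsPseudolineArrangement L ∧
    ∀ h ∈ H, ∃ γ ∈ L, h = pointsBelow γ ∨ h = pointsAbove γ

/-!
The proof is a one-step cutting argument by random sampling. After keeping the more frequent type
and possibly reflecting the plane in the horizontal axis, every pseudohalfplane may be taken to be
the set of points strictly below the graph of a continuous function, and two of the functions agree
at exactly one place.

For a set `S` of curves, two points are in the same cell (`SameCell`) if they are on the same sides
of the curves in `S` and these curves meet the vertical lines through the two points in the same
order. There are at most `2 ^ (k + k ^ 2)` cells if `S` has `k` elements. The geometric input is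
that at most six members of a finite family `T` of curves cross the cell of a given point `p` with
respect to the other members (`card_crosses_erase_le_six`). Indeed, let `t` be the lowest of those
of them that lie above `p`. Any other one has to drop below `t` before it reaches the cell. Since
two curves meet only once it then stays below `t`, so it can only be the first one to do so on the
left or on the right of `p`; any further one would have left the cell of `p`. The curves below `p`
are treated in the same way.

Averaging over all `T` of size `k + 1` (backward analysis, `exists_sample`) gives a set `S` of `k`
curves such that an average point has a cell crossed by at most a fraction `6 / (k + 1)` of all the
curves. With `k = 23`, half of the points have a cell crossed by at most half of the curves, and a
constant proportion of these points share a cell. The curves that do not cross this cell have it on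
one side, and half of them have it on the same side (`exists_homogeneous`).
-/

open Finset

/-! ### Curves crossing at most once -/

/-- A difference of two continuous functions with at most one zero keeps its sign beyond a point
`z` at which that sign differs from the one at `a`. -/
theorem lt_of_single_crossing {g h : ℝ → ℝ} (hg : Continuous g) (hh : Continuous h)
    (huniq : ∀ u v, g u = h u → g v = h v → u = v) {a z w : ℝ}
    (ha : h a ≤ g a) (hz : g z < h z) (hzw : z ∈ Set.uIcc a w) : g w < h w := by
  by_contra! hw
  have hc : Continuous fun x => g x - h x := hg.sub hh
  obtain ⟨u, hu, hu0⟩ : (0 : ℝ) ∈ (fun x => g x - h x) '' Set.uIcc a z :=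
    intermediate_value_uIcc hc.continuousOn
      (Set.mem_uIcc.2 (Or.inr ⟨by linarith, by linarith⟩))
  obtain ⟨v, hv, hv0⟩ : (0 : ℝ) ∈ (fun x => g x - h x) '' Set.uIcc z w :=
    intermediate_value_uIcc hc.continuousOn
      (Set.mem_uIcc.2 (Or.inl ⟨by linarith, by linarith⟩))
  have huv : u = v := huniq u v (sub_eq_zero.1 hu0) (sub_eq_zero.1 hv0)
  subst huv
  have huz : u = z := by
    rw [Set.mem_uIcc] at hu hv hzw
    rcases hu with hu | hu <;> rcases hv with hv | hv <;> rcases hzw with hzw | hzw <;> linarith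
  subst huz
  simp only at hu0
  linarith

/-- If each property `φ i` persists, moving away from `a`, once it holds, then at most two indices
have `φ i` holding at a place where all the other properties fail: the first one to the left and the
first one to the right of `a`. -/
theorem card_first_le_two {ι : Type*} (U : Finset ι) (φ : ι → ℝ → Prop) (a : ℝ)
    (hφ : ∀ i ∈ U, ∀ z w, φ i z → z ∈ Set.uIcc a w → φ i w)
    (hU : ∀ i ∈ U, ∃ z, φ i z ∧ ∀ j ∈ U, j ≠ i → ¬ φ j z) : U.card ≤ 2 := by
  classical
  choose! z hz hz' using hU
  have hl : (U.filter fun i => z i ≤ a).card ≤ 1 := by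
    refine card_le_one.2 fun i hi j hj => ?_
    rw [mem_filter] at hi hj
    by_contra hij
    rcases le_total (z i) (z j) with h | h
    · exact hz' i hi.1 j hj.1 (Ne.symm hij)
        (hφ j hj.1 _ _ (hz j hj.1) (Set.mem_uIcc.2 (Or.inr ⟨h, hj.2⟩)))
    · exact hz' j hj.1 i hi.1 hij
        (hφ i hi.1 _ _ (hz i hi.1) (Set.mem_uIcc.2 (Or.inr ⟨h, hi.2⟩)))
  have hr : (U.filter fun i => ¬ z i ≤ a).card ≤ 1 := by
    refine card_le_one.2 fun i hi j hj => ?_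
    rw [mem_filter, not_le] at hi hj
    by_contra hij
    rcases le_total (z i) (z j) with h | h
    · exact hz' j hj.1 i hi.1 hij
        (hφ i hi.1 _ _ (hz i hi.1) (Set.mem_uIcc.2 (Or.inl ⟨hi.2.le, h⟩)))
    · exact hz' i hi.1 j hj.1 (Ne.symm hij)
        (hφ j hj.1 _ _ (hz j hj.1) (Set.mem_uIcc.2 (Or.inl ⟨hj.2.le, h⟩)))
  have := card_filter_add_card_filter_not (s := U) (fun i => z i ≤ a)
  omega

/-! ### Cells of a sample of curves -/

section Cells

variable {α ι : Type*} (x y : α → ℝ) (f : ι → ℝ → ℝ)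

/-- The points with coordinates `(x p, y p)` and `(x q, y q)` lie on the same side of each curve
`f i`, `i ∈ S`, and these curves meet the vertical lines through the two points in the same order.
Being on or above a curve counts as one side. -/
def SameCell (S : Finset ι) (p q : α) : Prop :=
  (∀ i ∈ S, y p < f i (x p) ↔ y q < f i (x q)) ∧
    ∀ i ∈ S, ∀ j ∈ S, f i (x p) < f j (x p) ↔ f i (x q) < f j (x q)

/-- The curve `f i` separates `p` from some point in its cell with respect to `S`. -/
def Crosses (S : Finset ι) (i : ι) (p : α) : Prop :=
  ∃ q, SameCell x y f S p q ∧ ¬ (y p < f i (x p) ↔ y q < f i (x q))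

variable {x y f}

/-- At most three curves above `p` cross the cell of `p` with respect to the remaining ones. -/
theorem card_crosses_above_le [DecidableEq ι] (T : Finset ι) (p : α)
    (hc : ∀ i ∈ T, Continuous (f i))
    (hu : ∀ i ∈ T, ∀ j ∈ T, i ≠ j → ∀ u v, f i u = f j u → f i v = f j v → u = v)
    (U : Finset ι) (hUT : U ⊆ T)
    (hU : ∀ i ∈ U, Crosses x y f (T.erase i) i p ∧ y p < f i (x p)) : U.card ≤ 3 := by
  rcases U.eq_empty_or_nonempty with rfl | hne
  · simp
  -- `f t` bounds the cell of `p` from above; apart from `t`, only the first curves that cross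
  -- `f t` to the left and to the right of `p` can cut the cell from above.
  obtain ⟨t, ht, htmin⟩ := exists_min_image U (fun i => f i (x p)) hne
  have : (U.erase t).card ≤ 2 := by
    refine card_first_le_two (U.erase t) (fun i z => f i z < f t z) (x p) ?_ ?_
    · intro i hi z w hz hzw
      have hi' := mem_erase.1 hi
      exact lt_of_single_crossing (hc i (hUT hi'.2)) (hc t (hUT ht))
        (hu i (hUT hi'.2) t (hUT ht) hi'.1) (htmin i hi'.2) hz hzw
    · intro i hi
      have hi' := mem_erase.1 hi
      obtain ⟨⟨q, hq, hne⟩, hpi⟩ := hU i hi'.2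
      have htT : t ∈ T.erase i := mem_erase.2 ⟨hi'.1.symm, hUT ht⟩
      have hqi : f i (x q) ≤ y q := by
        by_contra! h
        exact hne ⟨fun _ => h, fun _ => hpi⟩
      refine ⟨x q, hqi.trans_lt ((hq.1 t htT).1 (hU t ht).2), fun j hj hji hlt => ?_⟩
      have hj' := mem_erase.1 hj
      exact absurd ((hq.2 j (mem_erase.2 ⟨hji, hUT hj'.2⟩) t htT).2 hlt)
        (htmin j hj'.2).not_gt
  have := card_erase_of_mem ht
  omega

/-- At most three curves on or below `p` cross the cell of `p` with respect to the remaining ones. -/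
theorem card_crosses_below_le [DecidableEq ι] (T : Finset ι) (p : α)
    (hc : ∀ i ∈ T, Continuous (f i))
    (hu : ∀ i ∈ T, ∀ j ∈ T, i ≠ j → ∀ u v, f i u = f j u → f i v = f j v → u = v)
    (U : Finset ι) (hUT : U ⊆ T)
    (hU : ∀ i ∈ U, Crosses x y f (T.erase i) i p ∧ ¬ y p < f i (x p)) : U.card ≤ 3 := by
  rcases U.eq_empty_or_nonempty with rfl | hne
  · simp
  obtain ⟨t, ht, htmax⟩ := exists_max_image U (fun i => f i (x p)) hne
  have : (U.erase t).card ≤ 2 := by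
    refine card_first_le_two (U.erase t) (fun i z => f t z < f i z) (x p) ?_ ?_
    · intro i hi z w hz hzw
      have hi' := mem_erase.1 hi
      exact lt_of_single_crossing (hc t (hUT ht)) (hc i (hUT hi'.2))
        (hu t (hUT ht) i (hUT hi'.2) hi'.1.symm) (htmax i hi'.2) hz hzw
    · intro i hi
      have hi' := mem_erase.1 hi
      obtain ⟨⟨q, hq, hne⟩, hpi⟩ := hU i hi'.2
      have htT : t ∈ T.erase i := mem_erase.2 ⟨hi'.1.symm, hUT ht⟩
      have hqi : y q < f i (x q) := by
        by_contra h
        exact hne ⟨fun h' => absurd h' hpi, fun h' => absurd h' h⟩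
      have hqt : f t (x q) ≤ y q := not_lt.1 fun h => (hU t ht).2 ((hq.1 t htT).2 h)
      refine ⟨x q, hqt.trans_lt hqi, fun j hj hji hlt => ?_⟩
      have hj' := mem_erase.1 hj
      exact absurd ((hq.2 t htT j (mem_erase.2 ⟨hji, hUT hj'.2⟩)).2 hlt)
        (htmax j hj'.2).not_gt
  have := card_erase_of_mem ht
  omega

open Classical in
/-- The cell of a point is determined by at most six curves: in any finite family, at most six
members cut the cell of `p` with respect to the remaining ones. -/
theorem card_crosses_erase_le_six (T : Finset ι) (p : α)
    (hc : ∀ i ∈ T, Continuous (f i))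
    (hu : ∀ i ∈ T, ∀ j ∈ T, i ≠ j → ∀ u v, f i u = f j u → f i v = f j v → u = v) :
    (T.filter fun i => Crosses x y f (T.erase i) i p).card ≤ 6 := by
  set C := T.filter fun i => Crosses x y f (T.erase i) i p with hC
  have hCT : C ⊆ T := filter_subset _ _
  have h1 := card_crosses_above_le T p hc hu (C.filter fun i => y p < f i (x p))
    ((filter_subset _ _).trans hCT) (fun i hi => by
      obtain ⟨hi, h⟩ := mem_filter.1 hi
      exact ⟨(mem_filter.1 hi).2, h⟩)
  have h2 := card_crosses_below_le T p hc hu (C.filter fun i => ¬ y p < f i (x p))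
    ((filter_subset _ _).trans hCT) (fun i hi => by
      obtain ⟨hi, h⟩ := mem_filter.1 hi
      exact ⟨(mem_filter.1 hi).2, h⟩)
  have := card_filter_add_card_filter_not (s := C) (fun i => y p < f i (x p))
  omega

end Cells

/-! ### A sample whose cells are rarely crossed -/

/-- Choosing a `k`-set and then a further element amounts to choosing a `(k + 1)`-set and then one
of its elements. -/
theorem sum_powersetCard_sum_sdiff {ι : Type*} [DecidableEq ι] (F : Finset ι) (k : ℕ)
    (g : Finset ι → ι → ℕ) :
    ∑ S ∈ F.powersetCard k, ∑ i ∈ F \ S, g S i =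
      ∑ T ∈ F.powersetCard (k + 1), ∑ i ∈ T, g (T.erase i) i := by
  rw [sum_sigma', sum_sigma']
  refine sum_bij' (fun s _ => ⟨insert s.2 s.1, s.2⟩) (fun s _ => ⟨s.1.erase s.2, s.2⟩) ?_ ?_ ?_
    ?_ ?_
  · rintro ⟨S, i⟩ h
    simp only [mem_sigma, mem_powersetCard, mem_sdiff] at h ⊢
    exact ⟨⟨insert_subset h.2.1 h.1.1, by rw [card_insert_of_notMem h.2.2, h.1.2]⟩,
      mem_insert_self _ _⟩
  · rintro ⟨T, i⟩ h
    simp only [mem_sigma, mem_powersetCard, mem_sdiff] at h ⊢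
    refine ⟨⟨(erase_subset _ _).trans h.1.1, ?_⟩, h.1.1 h.2, notMem_erase _ _⟩
    rw [card_erase_of_mem h.2, h.1.2, Nat.add_sub_cancel]
  · rintro ⟨S, i⟩ h
    simp only [mem_sigma, mem_sdiff] at h
    simp [erase_insert h.2.2]
  · rintro ⟨T, i⟩ h
    simp only [mem_sigma] at h
    simp [insert_erase h.2]
  · rintro ⟨S, i⟩ h
    simp only [mem_sigma, mem_sdiff] at h
    simp [erase_insert h.2.2]

section Sampling

variable {α ι : Type*} {x y : α → ℝ} {f : ι → ℝ → ℝ}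

open Classical in
/-- Some `k` of the curves have cells that, on average over the points, are crossed by at most a
fraction `6 / (k + 1)` of all the curves. -/
theorem exists_sample (P : Finset α) (F : Finset ι) (k : ℕ) (hk : k ≤ F.card)
    (hc : ∀ i ∈ F, Continuous (f i))
    (hu : ∀ i ∈ F, ∀ j ∈ F, i ≠ j → ∀ u v, f i u = f j u → f i v = f j v → u = v) :
    ∃ S ⊆ F, S.card = k ∧
      (k + 1) * ∑ p ∈ P, (F.filter fun i => Crosses x y f S i p).card ≤
        6 * P.card * F.card := by
  have htotal : ∑ S ∈ F.powersetCard k, ∑ p ∈ P, (F.filter fun i => Crosses x y f S i p).card ≤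
      F.card.choose (k + 1) * (6 * P.card) := by
    have h1 : ∀ S ∈ F.powersetCard k, ∑ p ∈ P, (F.filter fun i => Crosses x y f S i p).card =
        ∑ i ∈ F \ S, ∑ p ∈ P, if Crosses x y f S i p then 1 else 0 := by
      intro S hS
      rw [sum_comm]
      refine sum_congr rfl fun p _ => ?_
      rw [card_filter]
      refine (sum_subset sdiff_subset fun i hi hiS => ?_).symm
      have hiS : i ∈ S := by
        by_contra h
        exact hiS (mem_sdiff.2 ⟨hi, h⟩)
      exact if_neg fun ⟨q, hq, hne⟩ => hne (hq.1 i hiS)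
    rw [sum_congr rfl h1,
      sum_powersetCard_sum_sdiff F k fun S i => ∑ p ∈ P, if Crosses x y f S i p then 1 else 0,
      ← card_powersetCard, ← smul_eq_mul]
    refine sum_le_card_nsmul _ _ _ fun T hT => ?_
    have hTF := (mem_powersetCard.1 hT).1
    rw [sum_comm, mul_comm, ← smul_eq_mul]
    refine sum_le_card_nsmul _ _ _ fun p _ => ?_
    rw [← card_filter]
    exact card_crosses_erase_le_six T p (fun i hi => hc i (hTF hi))
      (fun i hi j hj => hu i (hTF hi) j (hTF hj))
  have hne : (F.powersetCard k).Nonempty := powersetCard_nonempty.2 hk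
  by_contra! hcon
  have hlt : ∑ S ∈ F.powersetCard k, 6 * P.card * F.card <
      ∑ S ∈ F.powersetCard k,
        (k + 1) * ∑ p ∈ P, (F.filter fun i => Crosses x y f S i p).card :=
    sum_lt_sum_of_nonempty hne fun S hS =>
      hcon S (mem_powersetCard.1 hS).1 (mem_powersetCard.1 hS).2
  rw [sum_const, card_powersetCard, smul_eq_mul, ← mul_sum] at hlt
  have hchoose := Nat.choose_succ_right_eq F.card k
  have h2 : (k + 1) * (F.card.choose (k + 1) * (6 * P.card)) ≤
      F.card.choose k * (6 * P.card * F.card) := by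
    calc (k + 1) * (F.card.choose (k + 1) * (6 * P.card))
        = F.card.choose (k + 1) * (k + 1) * (6 * P.card) := by ring
      _ = F.card.choose k * (F.card - k) * (6 * P.card) := by rw [hchoose]
      _ ≤ F.card.choose k * F.card * (6 * P.card) := by gcongr; exact Nat.sub_le _ _
      _ = _ := by ring
  have h3 := Nat.mul_le_mul_left (k + 1) htotal
  exact (hlt.trans_le (h3.trans h2)).false

open Classical in
/-- The trace of the arrangement of the curves in `S` at `p`: the curves above `p`, and the vertical
order of the curves at the abscissa of `p`. -/
noncomputable def cellCode (x y : α → ℝ) (f : ι → ℝ → ℝ) (S : Finset ι) (p : α) :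
    Finset ι × Finset (ι × ι) :=
  (S.filter fun i => y p < f i (x p), (S ×ˢ S).filter fun ij => f ij.1 (x p) < f ij.2 (x p))

theorem sameCell_of_cellCode_eq {S : Finset ι} {p q : α}
    (h : cellCode x y f S p = cellCode x y f S q) : SameCell x y f S p q := by
  simp only [cellCode, Prod.mk.injEq, Finset.ext_iff, mem_filter, mem_product, Prod.forall] at h
  exact ⟨fun i hi => by simpa [hi] using h.1 i,
    fun i hi j hj => by simpa [hi, hj] using h.2 i j⟩

/-- A bound for the number of cells of `k` curves: the number of possible values of `cellCode`. It
is irreducible so that large powers of two are not evaluated. -/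
@[irreducible] def cellBound (k : ℕ) : ℕ := 2 ^ (k + k * k)

theorem le_cellBound {k : ℕ} (hk : 6 ≤ k) : 46 ≤ cellBound k := by
  rw [cellBound]
  calc 46 ≤ 2 ^ 6 := by norm_num
    _ ≤ 2 ^ (k + k * k) := Nat.pow_le_pow_right (by norm_num) (by omega)

theorem card_powerset_product (S : Finset ι) :
    (S.powerset ×ˢ (S ×ˢ S).powerset).card = cellBound S.card := by
  rw [card_product, card_powerset, card_powerset, card_product, ← pow_add, cellBound]

/-- A set of points and a family of curves pairwise meeting at most once contain subfamilies of
constant proportion in which all points are on the same side of all curves. -/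
theorem exists_homogeneous (P : Finset α) (F : Finset ι) (hP : P.Nonempty) (hF : 23 ≤ F.card)
    (hc : ∀ i ∈ F, Continuous (f i))
    (hu : ∀ i ∈ F, ∀ j ∈ F, i ≠ j → ∀ u v, f i u = f j u → f i v = f j v → u = v) :
    ∃ P₀ ⊆ P, ∃ F₀ ⊆ F, P.card ≤ 2 * (cellBound 23 * P₀.card) ∧ F.card ≤ 4 * F₀.card ∧
      ((∀ p ∈ P₀, ∀ i ∈ F₀, y p < f i (x p)) ∨ (∀ p ∈ P₀, ∀ i ∈ F₀, ¬ y p < f i (x p))) := by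
  classical
  -- Sample size `23` makes the average crossing fraction `6 / 24 = 1 / 4`.
  obtain ⟨S, hSF, hS, hsum⟩ := exists_sample (x := x) (y := y) P F 23 hF hc hu
  set cr : α → ℕ := fun p => (F.filter fun i => Crosses x y f S i p).card with hcr
  set G := P.filter fun p => 2 * cr p ≤ F.card with hG
  -- By Markov's inequality, half of the points have a cell crossed by at most half of the curves.
  have hGcard : P.card ≤ 2 * G.card := by
    have h1 : (P.filter fun p => ¬ 2 * cr p ≤ F.card).card * F.card ≤ 2 * ∑ p ∈ P, cr p := by
      rw [mul_sum, ← smul_eq_mul]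
      refine (card_nsmul_le_sum _ (fun p => 2 * cr p) F.card fun p hp => ?_).trans
        (sum_le_sum_of_subset (filter_subset _ _))
      exact (not_le.1 (mem_filter.1 hp).2).le
    have h2 := card_filter_add_card_filter_not (s := P) (fun p => 2 * cr p ≤ F.card)
    have h3 : (2 * (P.filter fun p => ¬ 2 * cr p ≤ F.card).card) * F.card ≤ P.card * F.card := by
      have h5 : 24 * ∑ p ∈ P, cr p ≤ 6 * (P.card * F.card) := by
        rw [← mul_assoc]
        exact hsum
      rw [mul_assoc]
      omega
    have h4 := Nat.le_of_mul_le_mul_right h3 (by omega)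
    simp only [hG]
    omega
  have hGne : G.Nonempty := by
    rw [← card_pos]
    have := hP.card_pos
    omega
  have hmaps : ∀ p ∈ G, cellCode x y f S p ∈ S.powerset ×ˢ (S ×ˢ S).powerset := fun p _ =>
    mem_product.2 ⟨mem_powerset.2 (filter_subset _ _), mem_powerset.2 (filter_subset _ _)⟩
  have hcodes : (S.powerset ×ˢ (S ×ˢ S).powerset).card = cellBound 23 := by
    rw [card_powerset_product, hS]
  obtain ⟨c, -, hc⟩ : ∃ c ∈ S.powerset ×ˢ (S ×ˢ S).powerset,
      G.card ≤ cellBound 23 * (G.filter fun p => cellCode x y f S p = c).card := by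
    by_contra! hcon
    have h1 := card_eq_sum_card_fiberwise hmaps
    have h2 : ∑ c ∈ S.powerset ×ˢ (S ×ˢ S).powerset,
        cellBound 23 * (G.filter fun p => cellCode x y f S p = c).card <
        ∑ c ∈ S.powerset ×ˢ (S ×ˢ S).powerset, G.card :=
      sum_lt_sum_of_nonempty ⟨_, hmaps _ hGne.choose_spec⟩ hcon
    rw [← mul_sum, ← h1, sum_const, hcodes, smul_eq_mul] at h2
    exact lt_irrefl _ h2
  set P₁ := G.filter fun p => cellCode x y f S p = c with hP₁
  have hP₁P : P₁ ⊆ P := (filter_subset _ _).trans (filter_subset _ _)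
  have hP₁card : P.card ≤ 2 * (cellBound 23 * P₁.card) := by
    omega
  obtain ⟨p₀, hp₀⟩ : P₁.Nonempty := by
    rw [nonempty_iff_ne_empty]
    intro h
    rw [h, card_empty, mul_zero, mul_zero] at hP₁card
    have := hP.card_pos
    omega
  -- The curves that do not cross the cell of `p₀` have `P₁` on one side.
  set N := F.filter fun i => ¬ Crosses x y f S i p₀ with hN
  have hNcard : F.card ≤ 2 * N.card := by
    have h1 := card_filter_add_card_filter_not (s := F) (fun i => Crosses x y f S i p₀)
    have h2 : 2 * cr p₀ ≤ F.card := (mem_filter.1 (mem_filter.1 hp₀).1).2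
    simp only [hcr] at h2
    simp only [hN]
    omega
  have hside : ∀ p ∈ P₁, ∀ i ∈ N, y p₀ < f i (x p₀) ↔ y p < f i (x p) := by
    intro p hp i hi
    by_contra hne
    exact (mem_filter.1 hi).2 ⟨p, sameCell_of_cellCode_eq
      ((mem_filter.1 hp₀).2.trans (mem_filter.1 hp).2.symm), hne⟩
  have hsplit := card_filter_add_card_filter_not (s := N) (fun i => y p₀ < f i (x p₀))
  rcases le_total (N.filter fun i => ¬ y p₀ < f i (x p₀)).card
    (N.filter fun i => y p₀ < f i (x p₀)).card with h | h
  · refine ⟨P₁, hP₁P, N.filter fun i => y p₀ < f i (x p₀),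
      (filter_subset _ N).trans (filter_subset _ _), hP₁card, by omega, Or.inl fun p hp i hi => ?_⟩
    exact (hside p hp i (mem_filter.1 hi).1).1 (mem_filter.1 hi).2
  · refine ⟨P₁, hP₁P, N.filter fun i => ¬ y p₀ < f i (x p₀),
      (filter_subset _ N).trans (filter_subset _ _), hP₁card, by omega, Or.inr fun p hp i hi => ?_⟩
    rw [← hside p hp i (mem_filter.1 hi).1]
    exact (mem_filter.1 hi).2

end Sampling

/-! ### Pseudohalfplanes -/

/-- Homogeneous pairs for pseudohalfplanes all lying on the same side (`σ = 1`: below, `σ = -1`: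
above) of their boundary curves. -/
theorem exists_homogeneous_pseudohalfplanes {L : Set (Set (ℝ × ℝ))} (hL : IsPseudolineArrangement L)
    (σ : ℝ) (P : Finset (ℝ × ℝ)) (H : Finset (Set (ℝ × ℝ))) (hP : P.Nonempty)
    (hcard : 23 ≤ H.card)
    (hH : ∀ h ∈ H, ∃ f : ℝ → ℝ, {p : ℝ × ℝ | p.2 = f p.1} ∈ L ∧ Continuous f ∧
      h = {p : ℝ × ℝ | σ * p.2 < σ * f p.1}) :
    ∃ P₀ ⊆ P, ∃ H₀ ⊆ H, P.card ≤ 2 * (cellBound 23 * P₀.card) ∧ H.card ≤ 4 * H₀.card ∧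
      ((∀ p ∈ P₀, ∀ h ∈ H₀, p ∈ h) ∨ (∀ p ∈ P₀, ∀ h ∈ H₀, p ∉ h)) := by
  have hσ : σ ≠ 0 := by
    rintro rfl
    obtain ⟨h, hh, h', hh', hne⟩ := one_lt_card.1 (show 1 < H.card by omega)
    obtain ⟨f, -, -, hf⟩ := hH h hh
    obtain ⟨f', -, -, hf'⟩ := hH h' hh'
    exact hne (by rw [hf, hf']; simp)
  choose! f hfL hfc hfh using hH
  obtain ⟨P₀, hP₀, H₀, hH₀, h1, h2, h3⟩ := exists_homogeneous (x := Prod.fst)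
    (y := fun p : ℝ × ℝ => σ * p.2) (f := fun h z => σ * f h z) P H hP hcard
    (fun h hh => continuous_const.mul (hfc h hh)) (fun h hh h' hh' hne u v hu hv => by
      have hne' : {p : ℝ × ℝ | p.2 = f h p.1} ≠ {p : ℝ × ℝ | p.2 = f h' p.1} := by
        intro heq
        apply hne
        have hfun : f h = f h' := funext fun z => by
          have : ((z, f h z) : ℝ × ℝ) ∈ {p : ℝ × ℝ | p.2 = f h p.1} := rfl
          rw [heq] at this
          exact this
        rw [hfh h hh, hfh h' hh', hfun]
      have hu' := mul_left_cancel₀ hσ hu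
      have hv' := mul_left_cancel₀ hσ hv
      have := (hL.2 _ (hfL h hh) _ (hfL h' hh') hne').unique
        (y₁ := (u, f h u)) (y₂ := (v, f h v)) ⟨rfl, hu'⟩ ⟨rfl, hv'⟩
      exact congrArg Prod.fst this)
  refine ⟨P₀, hP₀, H₀, hH₀, h1, h2, h3.imp ?_ ?_⟩
  · intro h p hp i hi
    rw [hfh i (hH₀ hi)]
    exact h p hp i hi
  · intro h p hp i hi
    rw [hfh i (hH₀ hi)]
    exact h p hp i hi

theorem pointsBelow_graph (f : ℝ → ℝ) :
    pointsBelow {p : ℝ × ℝ | p.2 = f p.1} = {p : ℝ × ℝ | 1 * p.2 < 1 * f p.1} := by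
  ext p
  simp [pointsBelow]

theorem pointsAbove_graph (f : ℝ → ℝ) :
    pointsAbove {p : ℝ × ℝ | p.2 = f p.1} = {p : ℝ × ℝ | -1 * p.2 < -1 * f p.1} := by
  ext p
  simp [pointsAbove]

theorem mainTheorem11 :
    ∃ c : ℝ, 0 < c ∧
      ∀ (n : ℕ) (P : Finset (ℝ × ℝ)) (H : Finset (Set (ℝ × ℝ))),
        P.card = n → H.card = n →
        IsPseudohalfplaneArrangement (H : Set (Set (ℝ × ℝ))) →
        ∃ P₀ ⊆ P, ∃ H₀ ⊆ H,
          P₀.card = H₀.card ∧ c * (n : ℝ) ≤ (P₀.card : ℝ) ∧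
          ((∀ p ∈ P₀, ∀ h ∈ H₀, p ∈ h) ∨ (∀ p ∈ P₀, ∀ h ∈ H₀, p ∉ h)) := by
  classical
  have hbig := le_cellBound (k := 23) (by norm_num)
  have hpos : 0 < ((2 * cellBound 23 : ℕ) : ℝ) := by
    rw [Nat.cast_pos]
    omega
  refine ⟨((2 * cellBound 23 : ℕ) : ℝ)⁻¹, inv_pos.2 hpos, fun n P H hPn hHn hH => ?_⟩
  -- It suffices to find a homogeneous pair whose two sizes may differ.
  suffices hmain : ∃ P₀ ⊆ P, ∃ H₀ ⊆ H,
      n ≤ 2 * (cellBound 23 * P₀.card) ∧ n ≤ 2 * (cellBound 23 * H₀.card) ∧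
      ((∀ p ∈ P₀, ∀ h ∈ H₀, p ∈ h) ∨ (∀ p ∈ P₀, ∀ h ∈ H₀, p ∉ h)) by
    obtain ⟨P₀, hP₀, H₀, hH₀, h1, h2, h3⟩ := hmain
    obtain ⟨P₁, hP₁, hP₁c⟩ := exists_subset_card_eq (min_le_left P₀.card H₀.card)
    obtain ⟨H₁, hH₁, hH₁c⟩ := exists_subset_card_eq (min_le_right P₀.card H₀.card)
    refine ⟨P₁, hP₁.trans hP₀, H₁, hH₁.trans hH₀, hP₁c.trans hH₁c.symm, ?_, h3.imp
      (fun h p hp i hi => h p (hP₁ hp) i (hH₁ hi)) (fun h p hp i hi => h p (hP₁ hp) i (hH₁ hi))⟩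
    have h4 : n ≤ 2 * cellBound 23 * P₁.card := by
      rw [hP₁c, mul_assoc]
      rcases min_choice P₀.card H₀.card with h | h <;> rw [h] <;> assumption
    rw [inv_mul_le_iff₀ hpos]
    exact_mod_cast h4
  rcases Nat.eq_zero_or_pos n with rfl | hn
  · exact ⟨∅, empty_subset _, ∅, empty_subset _, Nat.zero_le _, Nat.zero_le _, by simp⟩
  have hPne : P.Nonempty := card_pos.1 (hPn ▸ hn)
  rcases Nat.lt_or_ge n 46 with hsmall | hlarge
  · -- For bounded `n` a single point and a single pseudohalfplane suffice.
    obtain ⟨p, hp⟩ := hPne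
    obtain ⟨h, hh⟩ : H.Nonempty := card_pos.1 (hHn ▸ hn)
    refine ⟨{p}, singleton_subset_iff.2 hp, {h}, singleton_subset_iff.2 hh, ?_, ?_, ?_⟩
    · rw [card_singleton]; omega
    · rw [card_singleton]; omega
    · simpa using em (p ∈ h)
  obtain ⟨L, hL, hHL⟩ := hH
  -- Now `n ≥ 46 = 2 * 23`, so the half of the pseudohalfplanes that are of the same type
  -- (all below or all above their curves) contains a sample of size `23`.
  obtain ⟨σ, H', hH', hH'c, hσ⟩ : ∃ σ : ℝ, ∃ H' ⊆ H, n ≤ 2 * H'.card ∧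
      ∀ h ∈ H', ∃ f : ℝ → ℝ, {p : ℝ × ℝ | p.2 = f p.1} ∈ L ∧ Continuous f ∧
        h = {p : ℝ × ℝ | σ * p.2 < σ * f p.1} := by
    have hsplit := card_filter_add_card_filter_not (s := H) (fun h => ∃ γ ∈ L, h = pointsBelow γ)
    rcases le_total (H.filter fun h => ¬ ∃ γ ∈ L, h = pointsBelow γ).card
      (H.filter fun h => ∃ γ ∈ L, h = pointsBelow γ).card with hle | hle
    · refine ⟨1, H.filter fun h => ∃ γ ∈ L, h = pointsBelow γ, filter_subset _ _, by omega,
        fun h hh => ?_⟩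
      obtain ⟨γ, hγ, rfl⟩ := (mem_filter.1 hh).2
      obtain ⟨f, hf, rfl⟩ := hL.1 γ hγ
      exact ⟨f, hγ, hf, pointsBelow_graph f⟩
    · refine ⟨-1, H.filter fun h => ¬ ∃ γ ∈ L, h = pointsBelow γ, filter_subset _ _, by omega,
        fun h hh => ?_⟩
      obtain ⟨hhH, hnot⟩ := mem_filter.1 hh
      obtain ⟨γ, hγ, hbelow | rfl⟩ := hHL h hhH
      · exact absurd ⟨γ, hγ, hbelow⟩ hnot
      obtain ⟨f, hf, rfl⟩ := hL.1 γ hγ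
      exact ⟨f, hγ, hf, pointsAbove_graph f⟩
  obtain ⟨P₀, hP₀, H₀, hH₀, h1, h2, h3⟩ :=
    exists_homogeneous_pseudohalfplanes hL σ P H' hPne (by omega) hσ
  refine ⟨P₀, hP₀, H₀, hH₀.trans hH', by omega, ?_, h3⟩
  have h4 : 46 * H₀.card ≤ cellBound 23 * H₀.card := Nat.mul_le_mul_right _ hbig
  omega
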